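/- **Theorem 2.4.** Let $X$ be a Tychonoff (completely regular Hausdorff) space and let $C(X)$ be the group of continuous functions $X\to\mathbb R$ under pointwise addition. For $f\in C(X)$ and $\eta : X\to(0,\infty)$ put $W(f,\eta)=\{g\in C(X) : |g(x)-f(x)|<\eta(x)\text{ for all }x\in X\}$. Let $C_u(X)$, $C_m(X)$ and $C_\gamma(X)$ denote $C(X)$ with the group topology in which a local base at each $f$ consists of the sets $W(f,\eta)$, where $\eta$ ranges over the strictly positive constants, over the strictly positive continuous functions on $X$, and over the strictly positive lower semicontinuous real-valued functions on $X$, respectively (the topology of uniform convergence, the $m$-topology and the graph topology). A topological group $G$, written additively, is *$\aleph_0$-bounded* if for every neighborhood $U$ of $0$ there is a countable set $A\subseteq G$ with $G=A+U$. A space is *ccc* if every family of pairwise disjoint nonempty open sets in it is countable. A *network* of a space $Y$ is a family $\mathcal N$ of subsets of $Y$ such that for every $y\in Y$ and every neighborhood $U$ of $y$ there is $N\in\mathcal N$ with $y\in N\subseteq U$. The following twelve conditions are equivalent: 1. $C_\gamma(X)$ is $\aleph_0$-bounded; 2. $C_m(X)$ is $\aleph_0$-bounded; 3. $C_u(X)$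 is $\aleph_0$-bounded; 4. $C_u(X)$ is separable; 5. $X$ is compact and metrizable; 6. $C_\gamma(X)$ is second countable; 7. $C_\gamma(X)$ has a countable network; 8. $C_\gamma(X)$ is separable; 9. $C_\gamma(X)$ is ccc; 10. $C_m(X)$ is separable; 11. $C_m(X)$ is Lindelöf; 12. $C_m(X)$ is ccc. -/

import Mathlib

open scoped Pointwise Topology

/-- The set `W(f, η) = {g ∈ C(X) : |g x - f x| < η x for each x ∈ X}`. -/
def tube {X : Type*} [TopologicalSpace X] (f : C(X, ℝ)) (η : X → ℝ) : Set C(X, ℝ) :=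
  {g | ∀ x, |g x - f x| < η x}

/-- The strictly positive constant functions on `X`. -/
def uniformRadii (X : Type*) : Set (X → ℝ) :=
  {η | ∃ ε : ℝ, 0 < ε ∧ η = fun _ => ε}

/-- The strictly positive continuous functions on `X`. -/
def continuousRadii (X : Type*) [TopologicalSpace X] : Set (X → ℝ) :=
  {η | Continuous η ∧ ∀ x, 0 < η x}

/-- The strictly positive lower semicontinuous real-valued functions on `X`. -/
def lscRadii (X : Type*) [TopologicalSpace X] : Set (X → ℝ) :=
  {η | LowerSemicontinuous η ∧ ∀ x, 0 < η x}

/-- For a set `P` of strictly positive functions that is nonempty and closed under pointwise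
minima and halving, the sets `W(0, η)`, `η ∈ P`, are a base at `0` of a group topology. -/
def tubeBasis {X : Type*} [TopologicalSpace X] (P : Set (X → ℝ)) (hne : P.Nonempty)
    (hpos : ∀ η ∈ P, ∀ x, 0 < η x) (hmin : ∀ η ∈ P, ∀ θ ∈ P, (fun x => min (η x) (θ x)) ∈ P)
    (hhalf : ∀ η ∈ P, (fun x => η x / 2) ∈ P) : AddGroupFilterBasis C(X, ℝ) where
  sets := {U | ∃ η ∈ P, U = tube 0 η}
  nonempty := by
    obtain ⟨η, hη⟩ := hne
    exact ⟨_, η, hη, rfl⟩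
  inter_sets := by
    rintro _ _ ⟨η, hη, rfl⟩ ⟨θ, hθ, rfl⟩
    exact ⟨_, ⟨_, hmin η hη θ hθ, rfl⟩, fun g hg =>
      ⟨fun x => (lt_min_iff.1 (hg x)).1, fun x => (lt_min_iff.1 (hg x)).2⟩⟩
  zero' := by
    rintro _ ⟨η, hη, rfl⟩ x
    simpa using hpos η hη x
  add' := by
    rintro _ ⟨η, hη, rfl⟩
    refine ⟨_, ⟨_, hhalf η hη, rfl⟩, ?_⟩
    rintro _ ⟨g, hg, h, hh, rfl⟩ x
    have h1 := hg x
    have h2 := hh x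
    simp only [ContinuousMap.zero_apply, sub_zero, ContinuousMap.add_apply] at h1 h2 ⊢
    linarith [abs_add_le (g x) (h x)]
  neg' := by
    rintro _ ⟨η, hη, rfl⟩
    refine ⟨_, ⟨η, hη, rfl⟩, fun g hg x => ?_⟩
    simpa using hg x
  conj' := by
    rintro f _ ⟨η, hη, rfl⟩
    refine ⟨_, ⟨η, hη, rfl⟩, fun g hg x => ?_⟩
    simpa using hg x

theorem tubeBasis_nhds {X : Type*} [TopologicalSpace X] (P : Set (X → ℝ)) (hne : P.Nonempty)
    (hpos : ∀ η ∈ P, ∀ x, 0 < η x) (hmin : ∀ η ∈ P, ∀ θ ∈ P, (fun x => min (η x) (θ x)) ∈ P)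
    (hhalf : ∀ η ∈ P, (fun x => η x / 2) ∈ P) (f : C(X, ℝ)) :
    (@nhds _ (tubeBasis P hne hpos hmin hhalf).topology f).HasBasis (fun η => η ∈ P) (tube f) := by
  have hsub : ∀ η, (fun g => f + g) '' tube 0 η = tube f η := by
    intro η
    ext g
    constructor
    · rintro ⟨h, hh, rfl⟩ x
      simpa using hh x
    · intro hg
      exact ⟨g - f, fun x => by simpa using hg x, by simp⟩
  refine ((tubeBasis P hne hpos hmin hhalf).nhds_hasBasis f).to_hasBasis ?_ ?_
  · rintro _ ⟨η, hη, rfl⟩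
    exact ⟨η, hη, (hsub η).ge⟩
  · intro η hη
    exact ⟨_, ⟨η, hη, rfl⟩, (hsub η).le⟩

theorem uniformRadii_pos {X : Type*} : ∀ η ∈ uniformRadii X, ∀ x, 0 < η x := by
  rintro _ ⟨ε, hε, rfl⟩ _
  exact hε

theorem uniformRadii_nonempty {X : Type*} : (uniformRadii X).Nonempty := ⟨_, 1, one_pos, rfl⟩

theorem uniformRadii_min {X : Type*} : ∀ η ∈ uniformRadii X, ∀ θ ∈ uniformRadii X,
    (fun x => min (η x) (θ x)) ∈ uniformRadii X := by
  rintro _ ⟨ε, hε, rfl⟩ _ ⟨δ, hδ, rfl⟩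
  exact ⟨min ε δ, lt_min hε hδ, rfl⟩

theorem uniformRadii_half {X : Type*} : ∀ η ∈ uniformRadii X,
    (fun x => η x / 2) ∈ uniformRadii X := by
  rintro _ ⟨ε, hε, rfl⟩
  exact ⟨ε / 2, half_pos hε, rfl⟩

theorem continuousRadii_pos {X : Type*} [TopologicalSpace X] :
    ∀ η ∈ continuousRadii X, ∀ x, 0 < η x := fun _ hη => hη.2

theorem continuousRadii_nonempty {X : Type*} [TopologicalSpace X] :
    (continuousRadii X).Nonempty := ⟨fun _ => 1, continuous_const, fun _ => one_pos⟩

theorem continuousRadii_min {X : Type*} [TopologicalSpace X] :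
    ∀ η ∈ continuousRadii X, ∀ θ ∈ continuousRadii X,
      (fun x => min (η x) (θ x)) ∈ continuousRadii X :=
  fun _ hη _ hθ => ⟨hη.1.min hθ.1, fun x => lt_min (hη.2 x) (hθ.2 x)⟩

theorem continuousRadii_half {X : Type*} [TopologicalSpace X] :
    ∀ η ∈ continuousRadii X, (fun x => η x / 2) ∈ continuousRadii X :=
  fun _ hη => ⟨hη.1.div_const 2, fun x => half_pos (hη.2 x)⟩

theorem lscRadii_pos {X : Type*} [TopologicalSpace X] :
    ∀ η ∈ lscRadii X, ∀ x, 0 < η x := fun _ hη => hη.2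

theorem lscRadii_nonempty {X : Type*} [TopologicalSpace X] :
    (lscRadii X).Nonempty :=
  ⟨fun _ => 1, continuous_const.lowerSemicontinuous, fun _ => one_pos⟩

theorem lscRadii_min {X : Type*} [TopologicalSpace X] :
    ∀ η ∈ lscRadii X, ∀ θ ∈ lscRadii X, (fun x => min (η x) (θ x)) ∈ lscRadii X := by
  intro η hη θ hθ
  refine ⟨fun x y hy => ?_, fun x => lt_min (hη.2 x) (hθ.2 x)⟩
  filter_upwards [hη.1 x y (lt_min_iff.1 hy).1, hθ.1 x y (lt_min_iff.1 hy).2] with z h1 h2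
  exact lt_min h1 h2

theorem lscRadii_half {X : Type*} [TopologicalSpace X] :
    ∀ η ∈ lscRadii X, (fun x => η x / 2) ∈ lscRadii X := by
  intro η hη
  refine ⟨fun x y hy => ?_, fun x => half_pos (hη.2 x)⟩
  have hy' : y < η x / 2 := hy
  filter_upwards [hη.1 x (2 * y) (by linarith)] with z h1
  linarith

/-- `C_u(X)`: the group `C(X)` with the topology of uniform convergence. -/
def CU (X : Type*) [TopologicalSpace X] : Type _ := C(X, ℝ)

/-- `C_m(X)`: the group `C(X)` with the `m`-topology. -/
def CM (X : Type*) [TopologicalSpace X] : Type _ := C(X, ℝ)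

/-- `C_γ(X)`: the group `C(X)` with the graph topology. -/
def CGamma (X : Type*) [TopologicalSpace X] : Type _ := C(X, ℝ)

instance (X : Type*) [TopologicalSpace X] : AddCommGroup (CU X) :=
  inferInstanceAs (AddCommGroup C(X, ℝ))

instance (X : Type*) [TopologicalSpace X] : AddCommGroup (CM X) :=
  inferInstanceAs (AddCommGroup C(X, ℝ))

instance (X : Type*) [TopologicalSpace X] : AddCommGroup (CGamma X) :=
  inferInstanceAs (AddCommGroup C(X, ℝ))

instance (X : Type*) [TopologicalSpace X] : TopologicalSpace (CU X) :=
  (tubeBasis (uniformRadii X) uniformRadii_nonempty uniformRadii_pos uniformRadii_min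
    uniformRadii_half).topology

instance (X : Type*) [TopologicalSpace X] : TopologicalSpace (CM X) :=
  (tubeBasis (continuousRadii X) continuousRadii_nonempty continuousRadii_pos continuousRadii_min
    continuousRadii_half).topology

instance (X : Type*) [TopologicalSpace X] : TopologicalSpace (CGamma X) :=
  (tubeBasis (lscRadii X) lscRadii_nonempty lscRadii_pos lscRadii_min lscRadii_half).topology

instance (X : Type*) [TopologicalSpace X] : IsTopologicalAddGroup (CU X) :=
  (tubeBasis (uniformRadii X) uniformRadii_nonempty uniformRadii_pos uniformRadii_min
    uniformRadii_half).isTopologicalAddGroup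

instance (X : Type*) [TopologicalSpace X] : IsTopologicalAddGroup (CM X) :=
  (tubeBasis (continuousRadii X) continuousRadii_nonempty continuousRadii_pos continuousRadii_min
    continuousRadii_half).isTopologicalAddGroup

instance (X : Type*) [TopologicalSpace X] : IsTopologicalAddGroup (CGamma X) :=
  (tubeBasis (lscRadii X) lscRadii_nonempty lscRadii_pos lscRadii_min
    lscRadii_half).isTopologicalAddGroup

/-- A local base of `C_u(X)` at `f`: the sets `W(f, ε)` with `ε > 0` a constant. -/
theorem CU.nhds_hasBasis {X : Type*} [TopologicalSpace X] (f : CU X) :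
    (𝓝 f).HasBasis (fun η => η ∈ uniformRadii X) (tube (X := X) f) :=
  tubeBasis_nhds (uniformRadii X) uniformRadii_nonempty uniformRadii_pos uniformRadii_min
    uniformRadii_half f

/-- A local base of `C_m(X)` at `f`: the sets `W(f, ε)` with `ε` continuous and positive. -/
theorem CM.nhds_hasBasis {X : Type*} [TopologicalSpace X] (f : CM X) :
    (𝓝 f).HasBasis (fun η => η ∈ continuousRadii X) (tube (X := X) f) :=
  tubeBasis_nhds (continuousRadii X) continuousRadii_nonempty continuousRadii_pos
    continuousRadii_min continuousRadii_half f

/-- A local base of `C_γ(X)` at `f`: the sets `W(f, η)` with `η` lower semicontinuous and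
positive. -/
theorem CGamma.nhds_hasBasis {X : Type*} [TopologicalSpace X] (f : CGamma X) :
    (𝓝 f).HasBasis (fun η => η ∈ lscRadii X) (tube (X := X) f) :=
  tubeBasis_nhds (lscRadii X) lscRadii_nonempty lscRadii_pos lscRadii_min lscRadii_half f

/-- A topological group (written additively) is `ℵ₀`-bounded if for each neighborhood `U` of the
neutral element there is a countable set `A` such that the group equals `A + U`. -/
def IsAleph0Bounded (G : Type*) [AddGroup G] [TopologicalSpace G] [IsTopologicalAddGroup G] :
    Prop :=
  ∀ U ∈ 𝓝 (0 : G), ∃ A : Set G, A.Countable ∧ A + U = Set.univ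

/-- A space has a countable network: there is a countable family of (arbitrary) subsets such that
every neighborhood of every point contains a member of the family containing the point. -/
def HasCountableNetwork (Y : Type*) [TopologicalSpace Y] : Prop :=
  ∃ 𝒩 : Set (Set Y), 𝒩.Countable ∧ ∀ y : Y, ∀ U ∈ 𝓝 y, ∃ N ∈ 𝒩, y ∈ N ∧ N ⊆ U

/-- The countable chain condition: every family of pairwise disjoint nonempty open sets is
countable. -/
def IsCCC (Y : Type*) [TopologicalSpace Y] : Prop :=
  ∀ 𝒰 : Set (Set Y), (∀ U ∈ 𝒰, IsOpen U ∧ U.Nonempty) → 𝒰.PairwiseDisjoint id → 𝒰.Countable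

/-! Each of separability, the Lindelöf property and ccc forces a topological group to be
`ℵ₀`-bounded, and boundedness passes to the coarser topologies: from the graph topology to the
`m`-topology to the uniform one. So every condition implies that countably many functions
approximate all of `C(X, ℝ)` uniformly within 1/4. Cozero-type sets of these functions form a
countable base of `X`, and a diagonal argument excludes an infinite closed discrete subset, so `X`
is compact and metrizable. Conversely, on compact `X` a positive lower semicontinuous function is
bounded below by a positive constant, so all three topologies are the compact-open one, which is
second countable. -/

open Set TopologicalSpace Filter

section TopologicalAddGroup

variable {G : Type*} [AddGroup G] [TopologicalSpace G] [IsTopologicalAddGroup G]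

theorem TopologicalSpace.SeparableSpace.isCCC (Y : Type*) [TopologicalSpace Y]
    [SeparableSpace Y] : IsCCC Y := fun _ hU hd =>
  hd.countable_of_isOpen (fun U h => (hU U h).1) (fun U h => (hU U h).2)

theorem TopologicalSpace.SeparableSpace.isAleph0Bounded [SeparableSpace G] :
    IsAleph0Bounded G := by
  intro U hU
  obtain ⟨A, hA, hAd⟩ := SeparableSpace.exists_countable_dense (α := G)
  refine ⟨A, hA, eq_univ_of_forall fun g => ?_⟩
  have h : (fun a => -a + g) ⁻¹' U ∈ 𝓝 g :=
    (by fun_prop : Continuous fun a : G => -a + g).continuousAt (by simpa using hU)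
  obtain ⟨a, haA, haU⟩ := hAd.inter_nhds_nonempty h
  exact ⟨a, haA, -a + g, haU, by simp⟩

theorem LindelofSpace.isAleph0Bounded [LindelofSpace G] : IsAleph0Bounded G := by
  intro U hU
  have h : ∀ g : G, (fun a => -g + a) ⁻¹' U ∈ 𝓝 g := fun g =>
    (by fun_prop : Continuous fun a : G => -g + a).continuousAt (by simpa using hU)
  obtain ⟨A, hA, hcov⟩ := LindelofSpace.elim_nhds_subcover _ h
  refine ⟨A, hA, eq_univ_of_forall fun g => ?_⟩
  obtain ⟨a, ha, hg⟩ := mem_iUnion₂.1 (hcov ▸ mem_univ g)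
  exact ⟨a, ha, -a + g, hg, by simp⟩

/-- Take a maximal set `A` with pairwise disjoint translates `a + V`, where `V - V ⊆ U`. It is
countable by ccc, and maximality makes each `g + V` meet some `a + V`, so `g ∈ a + U`. -/
theorem IsCCC.isAleph0Bounded (hG : IsCCC G) : IsAleph0Bounded G := by
  intro U hU
  obtain ⟨V, hVo, h0, hVU⟩ : ∃ V : Set G, IsOpen V ∧ 0 ∈ V ∧ ∀ v ∈ V, ∀ w ∈ V, v - w ∈ U := by
    obtain ⟨V, hV, hVU⟩ := exists_nhds_half_neg hU
    obtain ⟨W, hWV, hWo, h0⟩ := mem_nhds_iff.1 hV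
    exact ⟨W, hWo, h0, fun v hv w hw => hVU v (hWV hv) w (hWV hw)⟩
  obtain ⟨A, hA⟩ := zorn_subset {A : Set G | A.PairwiseDisjoint fun a => (fun x => -a + x) ⁻¹' V}
    fun c hc hcc => ⟨⋃₀ c, (pairwiseDisjoint_sUnion hcc.directedOn).2 hc,
      fun s hs => subset_sUnion_of_mem hs⟩
  -- ccc counts sets, not indices; distinct indices give distinct translates because these are
  -- disjoint and nonempty.
  have hinj : InjOn (fun a => (fun x => -a + x) ⁻¹' V) A := by
    intro a ha b hb hab
    by_contra hne
    have := hA.prop ha hb hne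
    simp only [Function.onFun] at this
    have hab' : (fun x => -a + x) ⁻¹' V = (fun x => -b + x) ⁻¹' V := hab
    rw [← hab'] at this
    exact (disjoint_left.1 this : ∀ ⦃x⦄, _) (show -a + a ∈ V by simpa using h0)
      (show -a + a ∈ V by simpa using h0)
  have hAc : A.Countable := by
    refine countable_of_injective_of_countable_image hinj (hG _ ?_ ?_)
    · rintro _ ⟨a, -, rfl⟩
      exact ⟨hVo.preimage (by fun_prop), a, by simpa using h0⟩
    · rintro _ ⟨a, ha, rfl⟩ _ ⟨b, hb, rfl⟩ hne
      exact hA.prop ha hb fun h => hne (by rw [h])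
  refine ⟨A, hAc, eq_univ_of_forall fun g => ?_⟩
  by_cases hg : g ∈ A
  · exact ⟨g, hg, 0, mem_of_mem_nhds hU, add_zero g⟩
  by_contra hn
  have hins : (insert g A).PairwiseDisjoint fun a => (fun x => -a + x) ⁻¹' V := by
    refine hA.prop.insert fun a ha _ => disjoint_left.2 fun x hxg hxa => hn ?_
    refine ⟨a, ha, -a + g, ?_, by simp⟩
    -- `-a + g = (-a + x) - (-g + x)`, valid without commutativity.
    have := hVU _ hxa _ hxg
    simpa [sub_eq_add_neg, neg_add_rev, add_assoc] using this
  exact hg (hA.le_of_ge hins (subset_insert g A) (mem_insert g A))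

end TopologicalAddGroup

theorem HasCountableNetwork.separableSpace {Y : Type*} [TopologicalSpace Y]
    (h : HasCountableNetwork Y) : SeparableSpace Y := by
  obtain ⟨N, hN, hnet⟩ := h
  rcases isEmpty_or_nonempty Y with hY | hY
  · infer_instance
  choose! p hp using fun (s : Set Y) (hs : s.Nonempty) => hs
  refine ⟨⟨_, hN.image p, fun y => mem_closure_iff_nhds.2 fun U hU => ?_⟩⟩
  obtain ⟨s, hs, hys, hsU⟩ := hnet y U hU
  exact ⟨p s, hsU (hp s ⟨y, hys⟩), s, hs, rfl⟩

theorem SecondCountableTopology.hasCountableNetwork (Y : Type*) [TopologicalSpace Y]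
    [SecondCountableTopology Y] : HasCountableNetwork Y :=
  ⟨countableBasis Y, countable_countableBasis Y, fun _ _ hU =>
    (isBasis_countableBasis Y).mem_nhds_iff.1 hU⟩

theorem IsAleph0Bounded.exists_countable_approx {X : Type*} [TopologicalSpace X]
    (h : IsAleph0Bounded (CU X)) {ε : ℝ} (hε : 0 < ε) :
    ∃ A : Set C(X, ℝ), A.Countable ∧ ∀ f : C(X, ℝ), ∃ a ∈ A, f ∈ tube a fun _ => ε := by
  obtain ⟨A, hA, hAU⟩ := h _ ((CU.nhds_hasBasis (0 : CU X)).mem_of_mem ⟨ε, hε, rfl⟩)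
  refine ⟨A, hA, fun f => ?_⟩
  obtain ⟨a, ha, u, hu, hf⟩ := (hAU.symm ▸ mem_univ (α := CU X) f : _ ∈ A + _)
  refine ⟨a, ha, fun x => ?_⟩
  have hf' : f = (show C(X, ℝ) from a) + (show C(X, ℝ) from u) := hf.symm
  have hux : |(show C(X, ℝ) from u) x - (0 : C(X, ℝ)) x| < ε := hu x
  rw [hf', ContinuousMap.add_apply, add_sub_cancel_left]
  simpa using hux

theorem isAleph0Bounded_CM_of_CGamma {X : Type*} [TopologicalSpace X]
    (h : IsAleph0Bounded (CGamma X)) : IsAleph0Bounded (CM X) := by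
  intro U hU
  obtain ⟨η, hη, hηU⟩ := (CM.nhds_hasBasis (0 : CM X)).mem_iff.1 hU
  exact h U ((CGamma.nhds_hasBasis (0 : CGamma X)).mem_iff.2
    ⟨η, ⟨hη.1.lowerSemicontinuous, hη.2⟩, hηU⟩)

theorem isAleph0Bounded_CU_of_CM {X : Type*} [TopologicalSpace X]
    (h : IsAleph0Bounded (CM X)) : IsAleph0Bounded (CU X) := by
  intro U hU
  obtain ⟨η, ⟨ε, hε, rfl⟩, hηU⟩ := (CU.nhds_hasBasis (0 : CU X)).mem_iff.1 hU
  exact h U ((CM.nhds_hasBasis (0 : CM X)).mem_iff.2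
    ⟨_, ⟨continuous_const, fun _ => hε⟩, hηU⟩)

/-! ### From countable uniform approximation to compactness and metrizability -/

section Approximation

variable {X : Type*} [TopologicalSpace X]

theorem secondCountableTopology_of_countable_approx [CompletelyRegularSpace X]
    {A : Set C(X, ℝ)} (hA : A.Countable)
    (happ : ∀ f : C(X, ℝ), ∃ a ∈ A, f ∈ tube a fun _ => 1 / 4) : SecondCountableTopology X := by
  have hbasis : IsTopologicalBasis ((fun a : C(X, ℝ) => {x | 1 / 2 < a x}) '' A) := by
    refine isTopologicalBasis_of_isOpen_of_nhds ?_ fun x U hx hU => ?_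
    · rintro _ ⟨a, -, rfl⟩
      exact isOpen_lt continuous_const a.continuous
    · obtain ⟨f, hf, hfx, hfU⟩ := CompletelyRegularSpace.completely_regular x Uᶜ
        hU.isClosed_compl (not_not.2 hx)
      -- `1 - f` is 1 at `x` and 0 off `U`, so `a` exceeds 3/4 at `x` and stays below 1/4 off `U`.
      obtain ⟨a, ha, hfa⟩ := happ ⟨fun y => 1 - f y, by fun_prop⟩
      refine ⟨_, mem_image_of_mem _ ha, ?_, fun y hy => ?_⟩
      · have := abs_lt.1 (hfa x)
        simp only [ContinuousMap.coe_mk, hfx, Icc.coe_zero] at this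
        simp only [mem_ofPred_eq]
        linarith
      · by_contra hyU
        have h1 := abs_lt.1 (hfa y)
        have h2 : f y = 1 := hfU hyU
        simp only [ContinuousMap.coe_mk, h2, Icc.coe_one] at h1
        simp only [mem_ofPred_eq] at hy
        linarith
  exact hbasis.secondCountableTopology (hA.image _)

theorem exists_infinite_isClosed_discreteTopology [T1Space X] [LindelofSpace X]
    (hX : ¬ CompactSpace X) : ∃ B : Set X, B.Infinite ∧ IsClosed B ∧ DiscreteTopology B := by
  -- A Lindelöf countably compact space is compact; an infinite set without accumulation points is
  -- closed and discrete.
  have hcc : ¬ IsCountablyCompact (univ : Set X) := fun h =>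
    hX ⟨isLindelof_univ.isCompact h⟩
  rw [isCountablyCompact_iff_infinite_subset_has_accPt] at hcc
  push Not at hcc
  obtain ⟨B, -, hB, hacc⟩ := hcc
  have hBcl := isClosed_and_discrete_iff.2 fun x => not_not.1 fun h =>
    hacc x (mem_univ x) ⟨fun hb => h (disjoint_iff.2 hb)⟩
  exact ⟨B, hB, hBcl.1, hBcl.2.to_subtype⟩

theorem compactSpace_of_countable_approx [T1Space X] [NormalSpace X] [LindelofSpace X]
    {A : Set C(X, ℝ)} (hA : A.Countable) {ε : ℝ}
    (happ : ∀ f : C(X, ℝ), ∃ a ∈ A, f ∈ tube a fun _ => ε) : CompactSpace X := by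
  by_contra hX
  obtain ⟨B, hB, hBcl, hBd⟩ := exists_infinite_isClosed_discreteTopology hX
  have hAne : A.Nonempty := (happ 0).imp fun _ h => h.1
  obtain ⟨a, rfl⟩ := hA.exists_eq_range hAne
  have := hB.to_subtype
  let e := Infinite.natEmbedding B
  -- Diagonalization: by Tietze, some `g` equals `a n + ε` at the `n`-th chosen point of `B`, so no
  -- `a n` is within `ε` of `g`. Values at the other points of `B` are irrelevant.
  obtain ⟨g, hg⟩ := ContinuousMap.exists_restrict_eq hBcl
    (⟨fun b : B => a (Function.invFun e b) b + ε, continuous_of_discreteTopology⟩ : C(B, ℝ))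
  obtain ⟨_, ⟨n, rfl⟩, hn⟩ := happ g
  have hgn : g (e n) = a n (e n) + ε := by
    simpa [Function.leftInverse_invFun e.injective n] using DFunLike.congr_fun hg (e n)
  have := hn (e n)
  rw [hgn, add_sub_cancel_left] at this
  exact (le_abs_self ε).not_gt this

theorem IsAleph0Bounded.compactSpace_and_metrizableSpace [T35Space X]
    (h : IsAleph0Bounded (CU X)) : CompactSpace X ∧ MetrizableSpace X := by
  obtain ⟨A, hA, happ⟩ := h.exists_countable_approx (by norm_num : (0 : ℝ) < 1 / 4)
  have := secondCountableTopology_of_countable_approx hA happ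
  have : MetrizableSpace X := metrizableSpace_of_t3_secondCountable X
  exact ⟨compactSpace_of_countable_approx hA happ, this⟩

end Approximation

/-! ### Compact spaces: the three topologies coincide -/

section Compact

variable {X : Type*} [TopologicalSpace X] [CompactSpace X]

theorem LowerSemicontinuous.exists_pos_le {η : X → ℝ} (hη : LowerSemicontinuous η)
    (hpos : ∀ x, 0 < η x) : ∃ ε : ℝ, 0 < ε ∧ ∀ x, ε ≤ η x := by
  rcases isEmpty_or_nonempty X with hX | hX
  · exact ⟨1, one_pos, fun x => hX.elim x⟩
  obtain ⟨x, -, hx⟩ := (hη.lowerSemicontinuousOn univ).exists_isMinOn univ_nonempty isCompact_univ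
  exact ⟨η x, hpos x, fun y => hx (mem_univ y)⟩

theorem ContinuousMap.nhds_hasBasis_tube (f : C(X, ℝ)) :
    (𝓝 f).HasBasis (fun ε : ℝ => 0 < ε) fun ε => tube f fun _ => ε := by
  refine Metric.nhds_basis_ball.congr (fun _ => Iff.rfl) fun ε hε => ?_
  ext g
  simp only [Metric.mem_ball, ContinuousMap.dist_lt_iff hε, Real.dist_eq]
  rfl

/-- Every radius in `P` dominates a positive constant, since a lower semicontinuous function attains
its minimum on a compact space; so `P` and the constants give the same neighborhoods. -/
theorem eq_compactOpen_of_nhds_hasBasis (P : Set (X → ℝ)) (hP : P ⊆ lscRadii X)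
    (hconst : uniformRadii X ⊆ P) (t : TopologicalSpace C(X, ℝ))
    (ht : ∀ f, (@nhds _ t f).HasBasis (fun η => η ∈ P) (tube f)) :
    t = ContinuousMap.compactOpen := by
  refine TopologicalSpace.ext_nhds fun f => ?_
  refine (ht f).eq_of_same_basis (f.nhds_hasBasis_tube.to_hasBasis ?_ ?_)
  · exact fun ε hε => ⟨_, hconst ⟨ε, hε, rfl⟩, Subset.rfl⟩
  · intro η hη
    obtain ⟨ε, hε, hle⟩ := (hP hη).1.exists_pos_le (hP hη).2
    exact ⟨ε, hε, fun g hg x => (hg x).trans_le (hle x)⟩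

theorem uniformRadii_subset_continuousRadii (X : Type*) [TopologicalSpace X] :
    uniformRadii X ⊆ continuousRadii X := by
  rintro _ ⟨ε, hε, rfl⟩
  exact ⟨continuous_const, fun _ => hε⟩

theorem continuousRadii_subset_lscRadii (X : Type*) [TopologicalSpace X] :
    continuousRadii X ⊆ lscRadii X := fun _ hη => ⟨hη.1.lowerSemicontinuous, hη.2⟩

variable [T2Space X] [SecondCountableTopology X]

theorem secondCountableTopology_CU : SecondCountableTopology (CU X) := by
  have h := eq_compactOpen_of_nhds_hasBasis (uniformRadii X)
    ((uniformRadii_subset_continuousRadii X).trans (continuousRadii_subset_lscRadii X))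
    Subset.rfl (inferInstanceAs (TopologicalSpace (CU X))) CU.nhds_hasBasis
  have h2 : SecondCountableTopology C(X, ℝ) := inferInstance
  rw [← h] at h2
  exact h2

theorem secondCountableTopology_CM : SecondCountableTopology (CM X) := by
  have h := eq_compactOpen_of_nhds_hasBasis (continuousRadii X)
    (continuousRadii_subset_lscRadii X) (uniformRadii_subset_continuousRadii X)
    (inferInstanceAs (TopologicalSpace (CM X))) CM.nhds_hasBasis
  have h2 : SecondCountableTopology C(X, ℝ) := inferInstance
  rw [← h] at h2
  exact h2

theorem secondCountableTopology_CGamma : SecondCountableTopology (CGamma X) := by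
  have h := eq_compactOpen_of_nhds_hasBasis (lscRadii X) Subset.rfl
    ((uniformRadii_subset_continuousRadii X).trans (continuousRadii_subset_lscRadii X))
    (inferInstanceAs (TopologicalSpace (CGamma X))) CGamma.nhds_hasBasis
  have h2 : SecondCountableTopology C(X, ℝ) := inferInstance
  rw [← h] at h2
  exact h2

end Compact

theorem theorem2p4 {X : Type*} [TopologicalSpace X] [T35Space X] :
    List.TFAE [
      IsAleph0Bounded (CGamma X),
      IsAleph0Bounded (CM X),
      IsAleph0Bounded (CU X),
      TopologicalSpace.SeparableSpace (CU X),
      CompactSpace X ∧ TopologicalSpace.MetrizableSpace X,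
      SecondCountableTopology (CGamma X),
      HasCountableNetwork (CGamma X),
      TopologicalSpace.SeparableSpace (CGamma X),
      IsCCC (CGamma X),
      TopologicalSpace.SeparableSpace (CM X),
      LindelofSpace (CM X),
      IsCCC (CM X)] := by
  have hcompact : CompactSpace X ∧ MetrizableSpace X → SecondCountableTopology X := by
    rintro ⟨_, _⟩
    let := metrizableSpaceMetric X
    infer_instance
  tfae_have 1 → 2 := isAleph0Bounded_CM_of_CGamma
  tfae_have 2 → 3 := isAleph0Bounded_CU_of_CM
  tfae_have 3 → 5 := fun h => h.compactSpace_and_metrizableSpace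
  tfae_have 5 → 6 := fun h =>
    have := hcompact h
    have := h.1
    secondCountableTopology_CGamma
  tfae_have 6 → 7 := fun h => h.hasCountableNetwork
  tfae_have 7 → 8 := fun h => h.separableSpace
  tfae_have 8 → 9 := fun h => h.isCCC
  tfae_have 9 → 1 := fun h => h.isAleph0Bounded
  tfae_have 5 → 4 := fun h =>
    have := hcompact h
    have := h.1
    have := secondCountableTopology_CU (X := X)
    inferInstance
  tfae_have 4 → 3 := fun h => h.isAleph0Bounded
  tfae_have 5 → 11 := fun h =>
    have := hcompact h
    have := h.1
    have := secondCountableTopology_CM (X := X)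
    inferInstance
  tfae_have 11 → 2 := fun h => h.isAleph0Bounded
  tfae_have 5 → 10 := fun h =>
    have := hcompact h
    have := h.1
    have := secondCountableTopology_CM (X := X)
    inferInstance
  tfae_have 10 → 12 := fun h => h.isCCC
  tfae_have 12 → 2 := fun h => h.isAleph0Bounded
  tfae_finish
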